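/- A linear $[n,k]$ code over a finite field $\mathbb{F}_q$ is a $k$-dimensional subspace $\mathcal{C}$ of $\mathbb{F}_q^n$; it is an $[n,k,d]$ code if moreover the minimum Hamming distance between two distinct codewords of $\mathcal{C}$ equals $d$. A generator matrix of $\mathcal{C}$ is a matrix whose rows form a basis of $\mathcal{C}$. The Euclidean dual is $\mathcal{C}^\perp=\{\mathbf{x}\in\mathbb{F}_q^n : \sum_{i=1}^n x_ic_i=0 \text{ for all } \mathbf{c}\in\mathcal{C}\}$, and $\mathcal{C}$ is called an LCD code if $\mathcal{C}\cap\mathcal{C}^\perp=\{\mathbf{0}\}$. An $[n,k]$ LCD code is called an optimal LCD code if its minimum distance is the largest among all $[n,k]$ LCD codes over $\mathbb{F}_q$. Ternary means $q=3$. There exists a ternary optimal LCD $[23,4,14]$ code. There also exist ternary LCD codes with parameters $[23,5,12]$, $[24,6,12]$ and $[25,5,14]$. More precisely, consider the following matrices over $\mathbb{F}_3$: \[ G_1=\left[\begin{array}{*{23}{c}} 1&0&0&0&2&1&1&2&0&1&0&0&1&2&1&0&1&1&1&1&1&2&1\\ 0&1&0&0&2&2&2&1&2&0&0&2&1&1&1&1&1&0&0&2&0&1&0\\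 0&0&1&0&2&1&0&1&2&1&1&2&0&2&2&2&0&1&0&0&2&1&2\\ 0&0&0&1&0&2&0&2&1&1&1&2&2&2&0&1&1&0&1&2&1&0&2 \end{array}\right], \] \[ G_2=\left[\begin{array}{*{23}{c}} 1&0&0&0&2&1&1&2&0&1&0&0&1&2&1&0&1&1&1&0&0&2&2\\ 0&1&0&0&2&2&2&1&2&0&0&2&1&1&1&1&1&0&0&2&0&1&1\\ 0&0&1&0&2&1&0&1&2&1&1&2&0&2&2&2&0&1&0&0&2&0&2\\ 0&0&0&1&0&2&0&2&1&1&1&2&2&2&0&1&1&0&1&2&1&0&2\\ 0&0&0&0&1&1&1&1&0&2&1&1&2&0&0&1&0&1&1&1&2&2&2 \end{array}\right], \] \[ G_3=\left[\begin{array}{*{24}{c}} 1&0&0&0&0&2&2&1&1&0&0&2&0&2&1&1&2&2&2&0&0&0&0&1\\ 0&1&0&2&0&1&0&0&2&0&2&1&1&0&2&1&2&1&0&2&2&2&2&1\\ 0&0&1&2&0&0&1&2&2&2&0&2&1&0&2&0&2&0&1&1&1&0&2&0\\ 0&0&0&0&1&1&1&1&2&2&2&2&1&1&1&1&0&0&0&0&0&1&1&1\\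 0&0&0&1&0&2&0&1&1&1&0&0&2&1&0&2&0&0&1&1&0&1&0&2\\ 0&0&0&0&0&0&1&2&1&1&0&1&1&1&0&1&2&2&0&2&1&1&0&2 \end{array}\right], \] \[ G_4=\left[\begin{array}{*{25}{c}} 1&0&0&0&0&2&2&0&0&0&1&1&0&2&1&1&1&2&2&1&2&1&0&2&0\\ 0&1&0&0&0&0&0&2&2&2&1&0&0&1&1&2&1&1&1&1&1&2&1&2&1\\ 0&0&1&0&0&2&1&2&2&0&2&0&2&2&2&0&0&2&1&1&2&0&2&0&0\\ 0&0&0&1&0&2&0&2&1&1&1&2&2&2&0&1&1&0&1&0&0&2&1&0&0\\ 0&0&0&0&1&1&1&1&0&2&1&1&2&0&0&1&0&1&1&1&2&1&2&2&2 \end{array}\right]. \] Then $G_1$ is a generator matrix of a ternary optimal LCD $[23,4,14]$ code, and $G_2$, $G_3$, $G_4$ are generator matrices of ternary LCD codes with parameters $[23,5,12]$, $[24,6,12]$ and $[25,5,14]$, respectively. -/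

import Mathlib

open Matrix

namespace LCDCode

/-- The Euclidean dual of a linear code `C` of length `n`. -/
def euclideanDual {F : Type*} [Field F] {n : ℕ} (C : Submodule F (Fin n → F)) :
    Submodule F (Fin n → F) where
  carrier := {x | ∀ c ∈ C, x ⬝ᵥ c = 0}
  zero_mem' := fun c _ => zero_dotProduct c
  add_mem' := fun hx hy c hc => by rw [add_dotProduct, hx c hc, hy c hc, add_zero]
  smul_mem' := fun a x hx c hc => by rw [smul_dotProduct, hx c hc, smul_zero]

/-- The Euclidean hull of a linear code. -/
def hull {F : Type*} [Field F] {n : ℕ} (C : Submodule F (Fin n → F)) :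
    Submodule F (Fin n → F) :=
  C ⊓ euclideanDual C

/-- A (Euclidean) LCD code: the hull is zero. -/
def IsLCD {F : Type*} [Field F] {n : ℕ} (C : Submodule F (Fin n → F)) : Prop :=
  hull C = ⊥

/-- `d` is the minimum of the Hamming distances between two distinct codewords of `C`. -/
def HasMinDist {F : Type*} [Field F] [DecidableEq F] {n : ℕ}
    (C : Submodule F (Fin n → F)) (d : ℕ) : Prop :=
  IsLeast {w : ℕ | ∃ u ∈ C, ∃ v ∈ C, u ≠ v ∧ hammingDist u v = w} d

/-- `C` is a linear LCD code with parameters `[n, k, d]`. -/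
def IsLCDCode {F : Type*} [Field F] [DecidableEq F] (n k d : ℕ)
    (C : Submodule F (Fin n → F)) : Prop :=
  IsLCD C ∧ Module.finrank F C = k ∧ HasMinDist C d

/-- `C` is an optimal LCD code with parameters `[n, k, d]`: its minimum distance `d` is the
largest among all LCD codes of length `n` and dimension `k` over `F`. -/
def IsOptimalLCDCode {F : Type*} [Field F] [DecidableEq F] (n k d : ℕ)
    (C : Submodule F (Fin n → F)) : Prop :=
  IsLCDCode n k d C ∧
    ∀ (C' : Submodule F (Fin n → F)) (d' : ℕ), IsLCDCode n k d' C' → d' ≤ d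

/-- The rows of `G` form a basis of the code `C`. -/
def IsGeneratorMatrix {F : Type*} [Field F] {k n : ℕ} (G : Matrix (Fin k) (Fin n) F)
    (C : Submodule F (Fin n → F)) : Prop :=
  LinearIndependent F G.row ∧ Submodule.span F (Set.range G.row) = C

/-- The generator matrix of the `[23, 4]` code. -/
def G1 : Matrix (Fin 4) (Fin 23) (ZMod 3) :=
  !![1, 0, 0, 0, 2, 1, 1, 2, 0, 1, 0, 0, 1, 2, 1, 0, 1, 1, 1, 1, 1, 2, 1;
     0, 1, 0, 0, 2, 2, 2, 1, 2, 0, 0, 2, 1, 1, 1, 1, 1, 0, 0, 2, 0, 1, 0;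
     0, 0, 1, 0, 2, 1, 0, 1, 2, 1, 1, 2, 0, 2, 2, 2, 0, 1, 0, 0, 2, 1, 2;
     0, 0, 0, 1, 0, 2, 0, 2, 1, 1, 1, 2, 2, 2, 0, 1, 1, 0, 1, 2, 1, 0, 2]

/-- The generator matrix of the `[23, 5]` code. -/
def G2 : Matrix (Fin 5) (Fin 23) (ZMod 3) :=
  !![1, 0, 0, 0, 2, 1, 1, 2, 0, 1, 0, 0, 1, 2, 1, 0, 1, 1, 1, 0, 0, 2, 2;
     0, 1, 0, 0, 2, 2, 2, 1, 2, 0, 0, 2, 1, 1, 1, 1, 1, 0, 0, 2, 0, 1, 1;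
     0, 0, 1, 0, 2, 1, 0, 1, 2, 1, 1, 2, 0, 2, 2, 2, 0, 1, 0, 0, 2, 0, 2;
     0, 0, 0, 1, 0, 2, 0, 2, 1, 1, 1, 2, 2, 2, 0, 1, 1, 0, 1, 2, 1, 0, 2;
     0, 0, 0, 0, 1, 1, 1, 1, 0, 2, 1, 1, 2, 0, 0, 1, 0, 1, 1, 1, 2, 2, 2]

/-- The generator matrix of the `[24, 6]` code. -/
def G3 : Matrix (Fin 6) (Fin 24) (ZMod 3) :=
  !![1, 0, 0, 0, 0, 2, 2, 1, 1, 0, 0, 2, 0, 2, 1, 1, 2, 2, 2, 0, 0, 0, 0, 1;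
     0, 1, 0, 2, 0, 1, 0, 0, 2, 0, 2, 1, 1, 0, 2, 1, 2, 1, 0, 2, 2, 2, 2, 1;
     0, 0, 1, 2, 0, 0, 1, 2, 2, 2, 0, 2, 1, 0, 2, 0, 2, 0, 1, 1, 1, 0, 2, 0;
     0, 0, 0, 0, 1, 1, 1, 1, 2, 2, 2, 2, 1, 1, 1, 1, 0, 0, 0, 0, 0, 1, 1, 1;
     0, 0, 0, 1, 0, 2, 0, 1, 1, 1, 0, 0, 2, 1, 0, 2, 0, 0, 1, 1, 0, 1, 0, 2;
     0, 0, 0, 0, 0, 0, 1, 2, 1, 1, 0, 1, 1, 1, 0, 1, 2, 2, 0, 2, 1, 1, 0, 2]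

/-- The generator matrix of the `[25, 5]` code. -/
def G4 : Matrix (Fin 5) (Fin 25) (ZMod 3) :=
  !![1, 0, 0, 0, 0, 2, 2, 0, 0, 0, 1, 1, 0, 2, 1, 1, 1, 2, 2, 1, 2, 1, 0, 2, 0;
     0, 1, 0, 0, 0, 0, 0, 2, 2, 2, 1, 0, 0, 1, 1, 2, 1, 1, 1, 1, 1, 2, 1, 2, 1;
     0, 0, 1, 0, 0, 2, 1, 2, 2, 0, 2, 0, 2, 2, 2, 0, 0, 2, 1, 1, 2, 0, 2, 0, 0;
     0, 0, 0, 1, 0, 2, 0, 2, 1, 1, 1, 2, 2, 2, 0, 1, 1, 0, 1, 0, 0, 2, 1, 0, 0;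
     0, 0, 0, 0, 1, 1, 1, 1, 0, 2, 1, 1, 2, 0, 0, 1, 0, 1, 1, 1, 2, 1, 2, 2, 2]

end LCDCode

namespace LCDCode

/-! ### Codes whose generator matrix has an invertible Gram matrix. -/

section GeneratorMatrix

variable {F : Type*} [Field F] {k n : ℕ} {G : Matrix (Fin k) (Fin n) F}
  {M : Matrix (Fin k) (Fin k) F}

/-- If the Gram matrix of the rows of `G` is invertible, a combination of the rows that is
orthogonal to every row is trivial. -/
theorem eq_zero_of_mulVec_vecMul_eq_zero (hM : M * (G * Gᵀ) = 1) {y : Fin k → F}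
    (hy : G *ᵥ (y ᵥ* G) = 0) : y = 0 := by
  have h : (G * Gᵀ) *ᵥ y = 0 := by
    rw [← mulVec_mulVec, mulVec_transpose, hy]
  calc y = (M * (G * Gᵀ)) *ᵥ y := by rw [hM, one_mulVec]
    _ = 0 := by rw [← mulVec_mulVec, h, mulVec_zero]

theorem vecMul_injective_of_gram_inverse (hM : M * (G * Gᵀ) = 1) :
    Function.Injective G.vecMul := by
  intro x y hxy
  have hxy : x ᵥ* G = y ᵥ* G := hxy
  refine sub_eq_zero.mp (eq_zero_of_mulVec_vecMul_eq_zero hM ?_)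
  rw [sub_vecMul, hxy, sub_self, mulVec_zero]

theorem mem_span_row_iff {x : Fin n → F} :
    x ∈ Submodule.span F (Set.range G.row) ↔ ∃ y, y ᵥ* G = x := by
  simp_rw [Submodule.mem_span_range_iff_exists_fun, vecMul_eq_sum]
  rfl

theorem isLCD_span_row (hM : M * (G * Gᵀ) = 1) :
    IsLCD (Submodule.span F (Set.range G.row)) := by
  refine (Submodule.eq_bot_iff _).2 fun x hx => ?_
  obtain ⟨hxC, hxD⟩ := hx
  obtain ⟨y, rfl⟩ := mem_span_row_iff.1 hxC
  rw [eq_zero_of_mulVec_vecMul_eq_zero hM (y := y) ?_, zero_vecMul]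
  funext i
  rw [mulVec, dotProduct_comm]
  exact hxD _ (Submodule.subset_span ⟨i, rfl⟩)

/-- By linearity distances are weights of differences. Allowing weight 0 in `hle` lets one test run
over all `y`. -/
theorem hasMinDist_span_row [DecidableEq F] {d : ℕ} (hinj : Function.Injective G.vecMul)
    (hle : ∀ y, hammingNorm (y ᵥ* G) = 0 ∨ d ≤ hammingNorm (y ᵥ* G))
    (hex : ∃ y, y ≠ 0 ∧ hammingNorm (y ᵥ* G) = d) :
    HasMinDist (Submodule.span F (Set.range G.row)) d := by
  constructor
  · obtain ⟨y, hy, hd⟩ := hex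
    refine ⟨y ᵥ* G, mem_span_row_iff.2 ⟨y, rfl⟩, 0, zero_mem _, fun h => hy (hinj ?_), ?_⟩
    · exact h.trans (zero_vecMul G).symm
    · rw [hammingDist_zero_right, hd]
  · rintro _ ⟨u, hu, v, hv, huv, rfl⟩
    obtain ⟨x, rfl⟩ := mem_span_row_iff.1 hu
    obtain ⟨y, rfl⟩ := mem_span_row_iff.1 hv
    rw [hammingDist_eq_hammingNorm, neg_add_eq_sub, ← sub_vecMul]
    refine (hle _).resolve_left fun h => huv (Eq.symm ?_)
    rwa [hammingNorm_eq_zero, sub_vecMul, sub_eq_zero] at h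

theorem isGeneratorMatrix_and_isLCDCode_span_row [DecidableEq F] {d : ℕ}
    (M : Matrix (Fin k) (Fin k) F) (hM : M * (G * Gᵀ) = 1)
    (hle : ∀ y, hammingNorm (y ᵥ* G) = 0 ∨ d ≤ hammingNorm (y ᵥ* G))
    (hex : ∃ y, y ≠ 0 ∧ hammingNorm (y ᵥ* G) = d) :
    IsGeneratorMatrix G (Submodule.span F (Set.range G.row)) ∧
      IsLCDCode n k d (Submodule.span F (Set.range G.row)) := by
  have hinj := vecMul_injective_of_gram_inverse hM
  have hli : LinearIndependent F G.row := Matrix.vecMul_injective_iff.1 hinj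
  refine ⟨⟨hli, rfl⟩, isLCD_span_row hM, ?_, hasMinDist_span_row hinj hle hex⟩
  rw [finrank_span_eq_card hli, Fintype.card_fin]

end GeneratorMatrix

/-! ### Counting common zeros in ternary codes. -/

section TernaryZeros

variable {n : ℕ}

/-- The coordinates in `S` at which the word `x` vanishes. -/
def zerosIn (S : Finset (Fin n)) (x : Fin n → ZMod 3) : Finset (Fin n) := S.filter (x · = 0)

theorem mem_zerosIn {S : Finset (Fin n)} {x : Fin n → ZMod 3} {i : Fin n} :
    i ∈ zerosIn S x ↔ i ∈ S ∧ x i = 0 := Finset.mem_filter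

/-- A coordinate in `S` is a zero of one of the four words `x`, `y`, `x + y`, `x - y`, unless it
is a common zero of all of them. -/
theorem card_zerosIn_add (S : Finset (Fin n)) (x y : Fin n → ZMod 3) :
    (zerosIn S x).card + (zerosIn S y).card + (zerosIn S (x + y)).card +
      (zerosIn S (x - y)).card = S.card + 3 * (zerosIn (zerosIn S x) y).card := by
  have key : ∀ s t : ZMod 3, (if s = 0 then 1 else 0) + (if t = 0 then 1 else 0) +
      (if s + t = 0 then 1 else 0) + (if s - t = 0 then 1 else 0) =
      1 + 3 * (if s = 0 ∧ t = 0 then 1 else 0) := by decide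
  rw [Finset.card_eq_sum_ones S]
  simp only [zerosIn, Finset.filter_filter, Finset.card_filter, Finset.mul_sum,
    ← Finset.sum_add_distrib, Pi.add_apply, Pi.sub_apply]
  exact Finset.sum_congr rfl fun i _ => key (x i) (y i)

variable {C : Submodule (ZMod 3) (Fin n → ZMod 3)}

/-- Two elements independent modulo `U` have a combination outside `U` vanishing at a given
coordinate. -/
theorem exists_apply_eq_zero_notMem {U : Submodule (ZMod 3) (Fin n → ZMod 3)}
    {b c : Fin n → ZMod 3} (hb : b ∈ C) (hc : c ∈ C) (hbU : b ∉ U)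
    (hcU : c ∉ U ⊔ Submodule.span (ZMod 3) {b}) (i : Fin n) :
    ∃ x ∈ C, x ∉ U ∧ x i = 0 := by
  have hbV : b ∈ U ⊔ Submodule.span (ZMod 3) {b} :=
    Submodule.mem_sup_right (Submodule.mem_span_singleton_self b)
  have key : ∀ s t : ZMod 3, s = 0 ∨ t = 0 ∨ t + s = 0 ∨ t - s = 0 := by decide
  rcases key (b i) (c i) with h | h | h | h
  · exact ⟨b, hb, hbU, h⟩
  · exact ⟨c, hc, fun h' => hcU (Submodule.mem_sup_left h'), h⟩
  · exact ⟨c + b, add_mem hc hb,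
      fun h' => hcU ((Submodule.add_mem_iff_left _ hbV).1 (Submodule.mem_sup_left h')), h⟩
  · exact ⟨c - b, sub_mem hc hb,
      fun h' => hcU ((Submodule.sub_mem_iff_left _ hbV).1 (Submodule.mem_sup_left h')), h⟩

/-- If `c ∉ U + ⟨b⟩`, then none of `c`, `b + c`, `b - c` lies in `U`. -/
theorem notMem_of_notMem_sup {U : Submodule (ZMod 3) (Fin n → ZMod 3)}
    {b c : Fin n → ZMod 3} (hcU : c ∉ U ⊔ Submodule.span (ZMod 3) {b}) :
    c ∉ U ∧ b + c ∉ U ∧ b - c ∉ U := by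
  have hbV : b ∈ U ⊔ Submodule.span (ZMod 3) {b} :=
    Submodule.mem_sup_right (Submodule.mem_span_singleton_self b)
  exact ⟨fun h => hcU (Submodule.mem_sup_left h),
    fun h => hcU ((Submodule.add_mem_iff_right _ hbV).1 (Submodule.mem_sup_left h)),
    fun h => hcU ((Submodule.sub_mem_iff_right _ hbV).1 (Submodule.mem_sup_left h))⟩

theorem exists_mem_notMem_of_finrank_lt {U : Submodule (ZMod 3) (Fin n → ZMod 3)}
    (h : Module.finrank (ZMod 3) U < Module.finrank (ZMod 3) C) : ∃ x ∈ C, x ∉ U :=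
  SetLike.not_le_iff_exists.1 fun hle => h.not_ge (Submodule.finrank_mono hle)

theorem finrank_sup_span_singleton_le (U : Submodule (ZMod 3) (Fin n → ZMod 3))
    (b : Fin n → ZMod 3) :
    Module.finrank (ZMod 3) ↥(U ⊔ Submodule.span (ZMod 3) {b}) ≤
      Module.finrank (ZMod 3) U + 1 :=
  (Submodule.finrank_add_le_finrank_add_finrank _ _).trans
    (Nat.add_le_add_left (by
      simpa using finrank_span_le_card (R := ZMod 3) ({b} : Set (Fin n → ZMod 3))) _)

end TernaryZeros

/-! ### Nonexistence of ternary [23,4] codes of distance at least 15. -/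

section NoCode

open Submodule

variable {C : Submodule (ZMod 3) (Fin 23 → ZMod 3)}

/-- The planes `a`, `b`, `a ± b` through a line with t points give 23 + 3t ≤ 32, or ≤ 31 if `a` has
fewer than 8 points. -/
theorem card_zerosIn_pair (hz : ∀ x ∈ C, x ≠ 0 → (zerosIn Finset.univ x).card ≤ 8)
    {a b : Fin 23 → ZMod 3} (ha : a ∈ C) (ha0 : a ≠ 0) (hb : b ∈ C)
    (hba : b ∉ span (ZMod 3) {a}) :
    (zerosIn (zerosIn Finset.univ a) b).card ≤ 3 ∧
    ((zerosIn Finset.univ a).card < 8 → (zerosIn (zerosIn Finset.univ a) b).card ≤ 2) := by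
  obtain ⟨h1, h2, h3⟩ := notMem_of_notMem_sup (U := ⊥) (by rwa [bot_sup_eq])
  simp only [mem_bot] at h1 h2 h3
  have key := card_zerosIn_add Finset.univ a b
  have := hz a ha ha0
  have := hz b hb h1
  have := hz _ (add_mem ha hb) h2
  have := hz _ (sub_mem ha hb) h3
  rw [Finset.card_univ, Fintype.card_fin] at key
  omega

theorem exists_notMem_span_singleton (hC : Module.finrank (ZMod 3) C = 4)
    (a : Fin 23 → ZMod 3) :
    ∃ x ∈ C, x ∉ span (ZMod 3) {a} := by
  have := finrank_sup_span_singleton_le ⊥ a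
  rw [bot_sup_eq, finrank_bot] at this
  exact exists_mem_notMem_of_finrank_lt (by omega)

theorem exists_notMem_span_pair (hC : Module.finrank (ZMod 3) C = 4)
    (a b : Fin 23 → ZMod 3) :
    ∃ x ∈ C, x ∉ span (ZMod 3) {a} ⊔ span (ZMod 3) {b} := by
  have := finrank_sup_span_singleton_le ⊥ a
  have := finrank_sup_span_singleton_le (span (ZMod 3) {a}) b
  rw [bot_sup_eq, finrank_bot] at *
  exact exists_mem_notMem_of_finrank_lt (by omega)

theorem exists_notMem_span_triple (hC : Module.finrank (ZMod 3) C = 4)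
    (a b c : Fin 23 → ZMod 3) :
    ∃ x ∈ C, x ∉ span (ZMod 3) {a} ⊔ span (ZMod 3) {b} ⊔ span (ZMod 3) {c} := by
  have := finrank_sup_span_singleton_le ⊥ a
  have := finrank_sup_span_singleton_le (span (ZMod 3) {a}) b
  have := finrank_sup_span_singleton_le (span (ZMod 3) {a} ⊔ span (ZMod 3) {b}) c
  rw [bot_sup_eq, finrank_bot] at *
  exact exists_mem_notMem_of_finrank_lt (by omega)

/-- For a common zero `i` of `a` and `b`, this supplies a third word through `i`, so that the triple
intersection counted by `card_zerosIn_add` is nonempty. -/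
theorem exists_apply_eq_zero_notMem_span_pair (hC : Module.finrank (ZMod 3) C = 4)
    {a b : Fin 23 → ZMod 3} (i : Fin 23) :
    ∃ x ∈ C, x ∉ span (ZMod 3) {a} ⊔ span (ZMod 3) {b} ∧ x i = 0 := by
  obtain ⟨c, hc, hcU⟩ := exists_notMem_span_pair hC a b
  obtain ⟨d, hd, hdU⟩ := exists_notMem_span_triple hC a b c
  exact exists_apply_eq_zero_notMem hc hd hcU hdU i

theorem exists_apply_eq_zero_notMem_span_singleton (hC : Module.finrank (ZMod 3) C = 4)
    {a : Fin 23 → ZMod 3} (i : Fin 23) :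
    ∃ x ∈ C, x ∉ span (ZMod 3) {a} ∧ x i = 0 := by
  obtain ⟨b, hb, hbU⟩ := exists_notMem_span_singleton hC a
  obtain ⟨c, hc, hcU⟩ := exists_notMem_span_pair hC a b
  exact exists_apply_eq_zero_notMem hb hc hbU hcU i

/-- If the words outside `⟨a⟩` have at most `m` zeros among those of `a`, then counting along the
lines through a zero of `a` bounds the number of zeros of `a`. -/
theorem card_zerosIn_le_of_forall_pair (hC : Module.finrank (ZMod 3) C = 4)
    {a : Fin 23 → ZMod 3} {m : ℕ}
    (h : ∀ b ∈ C, b ∉ span (ZMod 3) {a} → (zerosIn (zerosIn Finset.univ a) b).card ≤ m) :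
    (zerosIn Finset.univ a).card ≤ 4 * m - 3 := by
  rcases (zerosIn Finset.univ a).eq_empty_or_nonempty with h0 | ⟨i, hi⟩
  · simp [h0]
  obtain ⟨b, hb, hba, hbi⟩ := exists_apply_eq_zero_notMem_span_singleton hC (a := a) i
  obtain ⟨c, hc, hcU, hci⟩ := exists_apply_eq_zero_notMem_span_pair hC (a := a) (b := b) i
  obtain ⟨h1, h2, h3⟩ := notMem_of_notMem_sup hcU
  have key := card_zerosIn_add (zerosIn Finset.univ a) b c
  have hpos : 0 < (zerosIn (zerosIn (zerosIn Finset.univ a) b) c).card :=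
    Finset.card_pos.2 ⟨i, by simp only [mem_zerosIn] at hi ⊢; exact ⟨⟨hi, hbi⟩, hci⟩⟩
  have := h b hb hba
  have := h c hc h1
  have := h _ (add_mem hb hc) h2
  have := h _ (sub_mem hb hc) h3
  omega

/-- Five points of a plane of order three cannot meet every line in at most two points. -/
theorem card_zerosIn_ne_five (hC : Module.finrank (ZMod 3) C = 4)
    {a : Fin 23 → ZMod 3}
    (h : ∀ b ∈ C, b ∉ span (ZMod 3) {a} → (zerosIn (zerosIn Finset.univ a) b).card ≤ 2) :
    (zerosIn Finset.univ a).card ≠ 5 := by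
  intro h5
  -- The four lines through a point of multiplicity t give 5 + 3t ≤ 8, so t ≤ 1, and t = 1 forces
  -- two points on each line.
  have four : ∀ b ∈ C, b ∉ span (ZMod 3) {a} → ∀ c ∈ C,
      c ∉ span (ZMod 3) {a} ⊔ span (ZMod 3) {b} →
      (zerosIn (zerosIn (zerosIn Finset.univ a) b) c).card = 0 ∨
      (zerosIn (zerosIn (zerosIn Finset.univ a) b) c).card = 1 ∧
        (zerosIn (zerosIn Finset.univ a) b).card = 2 := by
    intro b hb hba c hc hcU
    obtain ⟨h1, h2, h3⟩ := notMem_of_notMem_sup hcU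
    have key := card_zerosIn_add (zerosIn Finset.univ a) b c
    have := h b hb hba
    have := h c hc h1
    have := h _ (add_mem hb hc) h2
    have := h _ (sub_mem hb hc) h3
    omega
  -- A line with a point on it is in the equality case at that point.
  have even : ∀ b ∈ C, b ∉ span (ZMod 3) {a} →
      (zerosIn (zerosIn Finset.univ a) b).card = 0 ∨
      (zerosIn (zerosIn Finset.univ a) b).card = 2 := by
    intro b hb hba
    rcases (zerosIn (zerosIn Finset.univ a) b).eq_empty_or_nonempty with h0 | ⟨i, hi⟩
    · simp [h0]
    obtain ⟨c, hc, hcU, hci⟩ := exists_apply_eq_zero_notMem_span_pair hC (a := a) (b := b) i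
    have hpos : 0 < (zerosIn (zerosIn (zerosIn Finset.univ a) b) c).card :=
      Finset.card_pos.2 ⟨i, mem_zerosIn.2 ⟨hi, hci⟩⟩
    have := four b hb hba c hc hcU
    omega
  -- Four terms equal to 0 or 2 have even sum, so 5 + 3t is even and t = 1.
  have one : ∀ b ∈ C, b ∉ span (ZMod 3) {a} → ∀ c ∈ C,
      c ∉ span (ZMod 3) {a} ⊔ span (ZMod 3) {b} →
      (zerosIn (zerosIn (zerosIn Finset.univ a) b) c).card = 1 ∧
        (zerosIn (zerosIn Finset.univ a) b).card = 2 := by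
    intro b hb hba c hc hcU
    obtain ⟨h1, h2, h3⟩ := notMem_of_notMem_sup hcU
    have key := card_zerosIn_add (zerosIn Finset.univ a) b c
    have := even b hb hba
    have := even c hc h1
    have := even _ (add_mem hb hc) h2
    have := even _ (sub_mem hb hc) h3
    omega
  obtain ⟨b, hb, hba⟩ := exists_notMem_span_singleton hC a
  obtain ⟨c, hc, hcU⟩ := exists_notMem_span_pair hC a b
  obtain ⟨d, hd, hdU⟩ := exists_notMem_span_triple hC a b c
  obtain ⟨h1, h2, h3⟩ := notMem_of_notMem_sup hdU
  -- Along the line `b`, four points of multiplicity 1 give 4 = 2 + 3u, with u the number of common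
  -- zeros of all four words: impossible.
  have key := card_zerosIn_add (zerosIn (zerosIn Finset.univ a) b) c d
  have := one b hb hba c hc hcU
  have := one b hb hba d hd h1
  have := one b hb hba _ (add_mem hc hd) h2
  have := one b hb hba _ (sub_mem hc hd) h3
  omega

/-- Below 8 points, every line of the plane has at most two, so the plane has at most 4 · 2 - 3 = 5,
and 5 is excluded. -/
theorem card_zerosIn_eq_eight_or_le_four (hC : Module.finrank (ZMod 3) C = 4)
    (hz : ∀ x ∈ C, x ≠ 0 → (zerosIn Finset.univ x).card ≤ 8)
    {a : Fin 23 → ZMod 3} (ha : a ∈ C) (ha0 : a ≠ 0) :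
    (zerosIn Finset.univ a).card = 8 ∨ (zerosIn Finset.univ a).card ≤ 4 := by
  have := hz a ha ha0
  by_cases h8 : (zerosIn Finset.univ a).card = 8
  · exact .inl h8
  have h : ∀ b ∈ C, b ∉ span (ZMod 3) {a} →
      (zerosIn (zerosIn Finset.univ a) b).card ≤ 2 :=
    fun b hb hba => (card_zerosIn_pair hz ha ha0 hb hba).2 (by omega)
  have := card_zerosIn_le_of_forall_pair hC h
  have := card_zerosIn_ne_five hC h
  omega

/-- Two common zeros need plane sizes summing to 29, but four 8s give 32 and at most three 8s give
at most 28. -/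
theorem card_zerosIn_pair_ne_two (hC : Module.finrank (ZMod 3) C = 4)
    (hz : ∀ x ∈ C, x ≠ 0 → (zerosIn Finset.univ x).card ≤ 8)
    {a b : Fin 23 → ZMod 3} (ha : a ∈ C) (ha0 : a ≠ 0)
    (hb : b ∈ C) (hba : b ∉ span (ZMod 3) {a}) :
    (zerosIn (zerosIn Finset.univ a) b).card ≠ 2 := by
  obtain ⟨h1, h2, h3⟩ := notMem_of_notMem_sup (U := ⊥) (by rwa [bot_sup_eq])
  simp only [mem_bot] at h1 h2 h3
  have key := card_zerosIn_add Finset.univ a b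
  have := card_zerosIn_eq_eight_or_le_four hC hz ha ha0
  have := card_zerosIn_eq_eight_or_le_four hC hz hb h1
  have := card_zerosIn_eq_eight_or_le_four hC hz (add_mem ha hb) h2
  have := card_zerosIn_eq_eight_or_le_four hC hz (sub_mem ha hb) h3
  rw [Finset.card_univ, Fintype.card_fin] at key
  omega

theorem card_zerosIn_eq_eight_or_le_one (hC : Module.finrank (ZMod 3) C = 4)
    (hz : ∀ x ∈ C, x ≠ 0 → (zerosIn Finset.univ x).card ≤ 8)
    {a : Fin 23 → ZMod 3} (ha : a ∈ C) (ha0 : a ≠ 0) :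
    (zerosIn Finset.univ a).card = 8 ∨ (zerosIn Finset.univ a).card ≤ 1 := by
  have := hz a ha ha0
  by_cases h8 : (zerosIn Finset.univ a).card = 8
  · exact .inl h8
  refine .inr (card_zerosIn_le_of_forall_pair hC (m := 1) fun b hb hba => ?_)
  have := (card_zerosIn_pair hz ha ha0 hb hba).2 (by omega)
  have := card_zerosIn_pair_ne_two hC hz ha ha0 hb hba
  omega

/-- The sum 23 + 3t is one of 23, 26, 29, 32. Three 8s and a size at most 1 give 24 or 25, fewer 8s
at most 18; only four 8s remain. -/
theorem card_zerosIn_pair_eq_three (hC : Module.finrank (ZMod 3) C = 4)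
    (hz : ∀ x ∈ C, x ≠ 0 → (zerosIn Finset.univ x).card ≤ 8)
    {a b : Fin 23 → ZMod 3} (ha : a ∈ C) (ha0 : a ≠ 0)
    (hb : b ∈ C) (hba : b ∉ span (ZMod 3) {a}) :
    (zerosIn (zerosIn Finset.univ a) b).card = 3 ∧ (zerosIn Finset.univ a).card = 8 := by
  obtain ⟨h1, h2, h3⟩ := notMem_of_notMem_sup (U := ⊥) (by rwa [bot_sup_eq])
  simp only [mem_bot] at h1 h2 h3
  have key := card_zerosIn_add Finset.univ a b
  have := card_zerosIn_eq_eight_or_le_one hC hz ha ha0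
  have := card_zerosIn_eq_eight_or_le_one hC hz hb h1
  have := card_zerosIn_eq_eight_or_le_one hC hz (add_mem ha hb) h2
  have := card_zerosIn_eq_eight_or_le_one hC hz (sub_mem ha hb) h3
  rw [Finset.card_univ, Fintype.card_fin] at key
  omega

/-- The nonzero words of a ternary `[23, 4]` code cannot all have at most eight zeros. -/
theorem false_of_card_zerosIn_le_eight (hC : Module.finrank (ZMod 3) C = 4)
    (hz : ∀ x ∈ C, x ≠ 0 → (zerosIn Finset.univ x).card ≤ 8) : False := by
  obtain ⟨a, ha, ha0⟩ := exists_notMem_span_singleton hC 0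
  have ha0 : a ≠ 0 := by
    rintro rfl
    exact ha0 (zero_mem _)
  obtain ⟨b, hb, hba⟩ := exists_notMem_span_singleton hC a
  obtain ⟨c, hc, hcU⟩ := exists_notMem_span_pair hC a b
  obtain ⟨h1, h2, h3⟩ := notMem_of_notMem_sup hcU
  -- All four lines have 3 points, and 4 · 3 = 8 + 3t has no integer solution.
  have key := card_zerosIn_add (zerosIn Finset.univ a) b c
  have := card_zerosIn_pair_eq_three hC hz ha ha0 hb hba
  have := card_zerosIn_pair_eq_three hC hz ha ha0 hc h1
  have := card_zerosIn_pair_eq_three hC hz ha ha0 (add_mem hb hc) h2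
  have := card_zerosIn_pair_eq_three hC hz ha ha0 (sub_mem hb hc) h3
  omega

/-- A ternary `[23, 4]` code has minimum distance at most `14`. -/
theorem le_fourteen_of_hasMinDist (hC : Module.finrank (ZMod 3) C = 4)
    {d : ℕ} (hd : HasMinDist C d) : d ≤ 14 := by
  by_contra! h
  refine false_of_card_zerosIn_le_eight hC fun x hx hx0 => ?_
  have h1 : d ≤ hammingNorm x :=
    hd.2 ⟨x, hx, 0, zero_mem _, hx0, hammingDist_zero_right x⟩
  have h2 : (zerosIn Finset.univ x).card + hammingNorm x = 23 := by
    simpa [zerosIn, hammingNorm] using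
      Finset.card_filter_add_card_filter_not (s := Finset.univ) (fun i => x i = 0)
  omega

end NoCode

/-! ### Exhaustive weight enumeration on lists of natural numbers. -/

section WeightEnumeration

variable {n : ℕ}

/-- The Hamming weight modulo three of a word of natural numbers. -/
def listWeight (w : List ℕ) : ℕ := (w.map fun a => a * a % 3).sum

/-- Whether every word of the coset of `w` modulo the ternary code generated by `rows` has weight
zero or at least `d`. -/
def weightsZeroOrGE (d : ℕ) : List (List ℕ) → List ℕ → Bool
  | [], w => (listWeight w).beq 0 || d.ble (listWeight w)
  | r :: rows, w => weightsZeroOrGE d rows w &&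
      (weightsZeroOrGE d rows (List.zipWith (fun a b => (a + b) % 3) w r) &&
        weightsZeroOrGE d rows (List.zipWith (fun a b => (a + 2 * b) % 3) w r))

theorem zipWith_ofFn (f : ℕ → ℕ → ℕ) (v w : Fin n → ℕ) :
    List.zipWith f (List.ofFn v) (List.ofFn w) = List.ofFn fun i => f (v i) (w i) :=
  List.ext_getElem (by simp) (by simp)

/-- Nonzero residues modulo 3 square to 1, so `a * a % 3` indicates a nonzero entry. -/
theorem listWeight_ofFn (w : Fin n → ℕ) :
    listWeight (List.ofFn w) = hammingNorm fun j => (w j : ZMod 3) := by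
  have key : ∀ a : ℕ, a * a % 3 = if (a : ZMod 3) ≠ 0 then 1 else 0 := by
    intro a
    simp only [ne_eq, ZMod.natCast_eq_zero_iff, Nat.dvd_iff_mod_eq_zero, Nat.mul_mod a a]
    have : a % 3 < 3 := Nat.mod_lt _ (by norm_num)
    interval_cases a % 3 <;> rfl
  simp only [listWeight, List.map_ofFn, List.sum_ofFn, hammingNorm, Finset.card_filter,
    Function.comp_apply, key]

/-- The shift `w` is arbitrary because the induction absorbs 0, 1 or 2 times the first row into it.
-/
theorem zero_or_le_hammingNorm_of_weightsZeroOrGE {d : ℕ} : ∀ {k : ℕ} (G : Fin k → Fin n → ℕ)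
    (w : Fin n → ℕ),
    weightsZeroOrGE d (List.ofFn fun i => List.ofFn (G i)) (List.ofFn w) = true →
    ∀ y : Fin k → ZMod 3,
      hammingNorm (fun j => (w j : ZMod 3) + ∑ i, y i * G i j) = 0 ∨
      d ≤ hammingNorm (fun j => (w j : ZMod 3) + ∑ i, y i * G i j)
  | 0, G, w, h, y => by
    simpa [weightsZeroOrGE, listWeight_ofFn] using h
  | k + 1, G, w, h, y => by
    simp only [List.ofFn_succ (n := k), weightsZeroOrGE, zipWith_ofFn, Bool.and_eq_true] at h
    have cases3 : ∀ s : ZMod 3, s = 0 ∨ s = 1 ∨ s = 2 := by decide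
    rcases cases3 (y 0) with h0 | h0 | h0
    · simpa [Fin.sum_univ_succ, h0] using
        zero_or_le_hammingNorm_of_weightsZeroOrGE _ _ h.1 (fun i => y i.succ)
    · simpa [Fin.sum_univ_succ, h0, add_assoc] using
        zero_or_le_hammingNorm_of_weightsZeroOrGE _ _ h.2.1 (fun i => y i.succ)
    · simpa [Fin.sum_univ_succ, h0, add_assoc] using
        zero_or_le_hammingNorm_of_weightsZeroOrGE _ _ h.2.2 (fun i => y i.succ)

theorem zero_or_le_hammingNorm_vecMul {k d : ℕ} {G : Matrix (Fin k) (Fin n) (ZMod 3)}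
    (h : weightsZeroOrGE d (List.ofFn fun i => List.ofFn fun j => (G i j).val)
      (List.ofFn fun _ : Fin n => 0) = true) (y : Fin k → ZMod 3) :
    hammingNorm (y ᵥ* G) = 0 ∨ d ≤ hammingNorm (y ᵥ* G) := by
  have := zero_or_le_hammingNorm_of_weightsZeroOrGE _ _ h y
  simp only [ZMod.natCast_val, ZMod.cast_id', id, Nat.cast_zero, zero_add] at this
  exact this

end WeightEnumeration

/-! ### Certificates for the four matrices: weight bounds, words of minimum weight, inverse Gram
matrices. -/

section Computations

theorem zero_or_le_hammingNorm_vecMul_G1 :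
    ∀ y, hammingNorm (y ᵥ* G1) = 0 ∨ 14 ≤ hammingNorm (y ᵥ* G1) :=
  zero_or_le_hammingNorm_vecMul (by decide +kernel)

theorem hammingNorm_vecMul_G1 : (![0, 1, 0, 0] : Fin 4 → ZMod 3) ≠ 0 ∧
    hammingNorm (![0, 1, 0, 0] ᵥ* G1) = 14 := by
  decide +kernel

theorem gram_inverse_G1 :
    !![0, 0, 1, 2; 0, 0, 1, 0; 1, 1, 1, 2; 2, 0, 2, 2] * (G1 * G1ᵀ) = 1 := by
  decide +kernel

theorem zero_or_le_hammingNorm_vecMul_G2 :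
    ∀ y, hammingNorm (y ᵥ* G2) = 0 ∨ 12 ≤ hammingNorm (y ᵥ* G2) :=
  zero_or_le_hammingNorm_vecMul (by decide +kernel)

theorem hammingNorm_vecMul_G2 : (![0, 1, 0, 0, 1] : Fin 5 → ZMod 3) ≠ 0 ∧
    hammingNorm (![0, 1, 0, 0, 1] ᵥ* G2) = 12 := by
  decide +kernel

theorem gram_inverse_G2 :
    !![2, 1, 2, 2, 2; 1, 0, 0, 2, 1; 2, 0, 2, 2, 2; 2, 2, 2, 2, 1; 2, 1, 2, 1, 2] *
      (G2 * G2ᵀ) = 1 := by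
  decide +kernel

theorem zero_or_le_hammingNorm_vecMul_G3 :
    ∀ y, hammingNorm (y ᵥ* G3) = 0 ∨ 12 ≤ hammingNorm (y ᵥ* G3) :=
  zero_or_le_hammingNorm_vecMul (by decide +kernel)

theorem hammingNorm_vecMul_G3 : (![0, 0, 0, 0, 1, 0] : Fin 6 → ZMod 3) ≠ 0 ∧
    hammingNorm (![0, 0, 0, 0, 1, 0] ᵥ* G3) = 12 := by
  decide +kernel

theorem gram_inverse_G3 :
    !![1, 1, 0, 0, 1, 0; 1, 2, 2, 0, 1, 2; 0, 2, 1, 2, 0, 1; 0, 0, 2, 1, 1, 0;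
         1, 1, 0, 1, 2, 1; 0, 2, 1, 0, 1, 1] * (G3 * G3ᵀ) = 1 := by
  decide +kernel

theorem zero_or_le_hammingNorm_vecMul_G4 :
    ∀ y, hammingNorm (y ᵥ* G4) = 0 ∨ 14 ≤ hammingNorm (y ᵥ* G4) :=
  zero_or_le_hammingNorm_vecMul (by decide +kernel)

theorem hammingNorm_vecMul_G4 : (![0, 0, 0, 1, 0] : Fin 5 → ZMod 3) ≠ 0 ∧
    hammingNorm (![0, 0, 0, 1, 0] ᵥ* G4) = 14 := by
  decide +kernel

theorem gram_inverse_G4 :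
    !![1, 2, 0, 0, 0; 2, 2, 1, 2, 1; 0, 1, 1, 0, 2; 0, 2, 0, 1, 1; 0, 1, 2, 1, 1] *
      (G4 * G4ᵀ) = 1 := by
  decide +kernel

end Computations

end LCDCode

theorem mainTheorem3 :
    (∃ C : Submodule (ZMod 3) (Fin 23 → ZMod 3),
      LCDCode.IsGeneratorMatrix LCDCode.G1 C ∧ LCDCode.IsOptimalLCDCode 23 4 14 C) ∧
    (∃ C : Submodule (ZMod 3) (Fin 23 → ZMod 3),
      LCDCode.IsGeneratorMatrix LCDCode.G2 C ∧ LCDCode.IsLCDCode 23 5 12 C) ∧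
    (∃ C : Submodule (ZMod 3) (Fin 24 → ZMod 3),
      LCDCode.IsGeneratorMatrix LCDCode.G3 C ∧ LCDCode.IsLCDCode 24 6 12 C) ∧
    (∃ C : Submodule (ZMod 3) (Fin 25 → ZMod 3),
      LCDCode.IsGeneratorMatrix LCDCode.G4 C ∧ LCDCode.IsLCDCode 25 5 14 C) := by
  obtain ⟨hG, hC⟩ := LCDCode.isGeneratorMatrix_and_isLCDCode_span_row _ LCDCode.gram_inverse_G1
      LCDCode.zero_or_le_hammingNorm_vecMul_G1 ⟨_, LCDCode.hammingNorm_vecMul_G1⟩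
  exact ⟨⟨_, hG, hC, fun C' d' h => LCDCode.le_fourteen_of_hasMinDist h.2.1 h.2.2⟩,
    ⟨_, LCDCode.isGeneratorMatrix_and_isLCDCode_span_row _ LCDCode.gram_inverse_G2
      LCDCode.zero_or_le_hammingNorm_vecMul_G2 ⟨_, LCDCode.hammingNorm_vecMul_G2⟩⟩,
    ⟨_, LCDCode.isGeneratorMatrix_and_isLCDCode_span_row _ LCDCode.gram_inverse_G3
      LCDCode.zero_or_le_hammingNorm_vecMul_G3 ⟨_, LCDCode.hammingNorm_vecMul_G3⟩⟩,
    ⟨_, LCDCode.isGeneratorMatrix_and_isLCDCode_span_row _ LCDCode.gram_inverse_G4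
      LCDCode.zero_or_le_hammingNorm_vecMul_G4 ⟨_, LCDCode.hammingNorm_vecMul_G4⟩⟩⟩
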